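/- A binary word is *run-constrained* if every (maximal) run of $1$s in it is immediately followed by a strictly longer run of $0$s. For $n\ge 0$ let $\mathcal R_n$ (the Fibonacci-run graph) be the graph whose vertices are the binary strings $r$ of length $n$ such that $r00$ is run-constrained, two vertices being adjacent iff they differ in exactly one coordinate. Let $d$ be the graph distance in $\mathcal R_n$. *H-type strings.* For $p\ge 0$ the two complete H-type strings ending with $p$ are $1\,0^{2}1^{3}\cdots 1^{2p+1}0^{2p+2}1^{p+1}0^{p}$ and $0\,1^{2}0^{3}\cdots 0^{2p+1}1^{2p+2}0^{p+1}0^{p}$, of length $2p^2+7p+4$. A pair of H-type strings ending with $p$ of length $n$ consists of the suffixes of length $n$ of these two strings (in either order). *Distance-barriers.* Let $a,b$ be binary strings of length $n$. A distance-barrier between $a$ and $b$ is a pair of factors $$\alpha'=1^{r_1}0^{s_1}1^{r_2}\cdots 0^{s_t}1^{r_{t+1}},\qquad \beta'=1^{r_1}1^{s_1}1^{r_2}\cdots 1^{s_t}1^{r_{t+1}}\qquad(t\ge 1,\ r_i,s_i\ge 1),$$ one of them in $a$ and the other in $b$, both beginning at the same coordinate, such that the coordinate directly before the factors, if there is one,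 is not $1$ in both strings, and likewise the coordinate directly after them. The blocks $1^{r_i}$ are its barriers, and $r_i$ is the thickness of the $i$-th barrier. Put $M=\max_i r_i$, let $C'=\sum_{i=1}^{t+1} r_i$, and let $C$ be the sum of all the $r_i$ except one that is equal to $M$. A distance-barrier is called maximal if the set of coordinates it occupies is not properly contained in that of another distance-barrier between $a$ and $b$. *NH-type strings.* Let $\mu,\nu$ be a pair of H-type strings of length $n$. Vertices $\alpha,\beta$ of $\mathcal R_n$ are a pair of NH-type strings obtained from $\mu,\nu$ if (i) for every $i$, $\alpha_i=\beta_i=0$ if and only if $\mu_i=\nu_i=0$, and (ii) every coordinate $i$ with $\alpha_i=\beta_i=1$ is occupied by exactly one maximal distance-barrier between $\alpha$ and $\beta$. **Lemma 3.10.** Let the vertices $\mu,\nu$ of $\mathcal R_n$ be a pair of H-type strings ending with $p$ of length $n$, and let the vertices $\alpha,\beta$ be a pair of NH-type strings obtained from $\mu,\nu$. Let $1,\dots,s$ enumerate, without repetition, all maximal distance-barriers between $\alpha$ and $\beta$, and let $M_k$, $C_k$, $C'_k$ be the numbers $M$, $C$, $C'$ of the $k$-th one. Then $\mathcal R_n$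 is connected (so that $d$ is finite) and $$d(\alpha,\beta)=d(\mu,\nu)+\sum_{k=1}^{s}(C_k-M_k)=d(\mu,\nu)+\sum_{k=1}^{s}(C'_k-2M_k).$$ -/

import Mathlib

namespace FibRun

/-- A binary word is run-constrained if every (maximal) run `1^r`, `r ≥ 1`, is immediately followed
by a run of more than `r` zeros. -/
def RunConstrained (w : List Bool) : Prop :=
  ∀ (u v : List Bool) (r : ℕ), 0 < r → w = u ++ List.replicate r true ++ v →
    u.getLast? ≠ some true → v.head? ≠ some true →
      List.replicate (r + 1) false <+: v

/-- The vertices of the Fibonacci-run graph: the strings `x` of length `n` such that `x00` is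
run-constrained. -/
def Vertex (n : ℕ) : Type :=
  {x : Fin n → Bool // RunConstrained (List.ofFn x ++ [false, false])}

/-- The Fibonacci-run graph `R_n`: two vertices are adjacent iff they differ in exactly one
coordinate. -/
def graph (n : ℕ) : SimpleGraph (Vertex n) where
  Adj x y := hammingDist x.1 y.1 = 1
  symm := ⟨fun x y h => by rw [hammingDist_comm]; exact h⟩
  loopless := ⟨fun x h => by simp at h⟩

/-- For `c = true` this is `1 0^2 1^3 ⋯ 1^(2p+1) 0^(2p+2) 1^(p+1) 0^p`, and for `c = false` it is
`0 1^2 0^3 ⋯ 0^(2p+1) 1^(2p+2) 0^(p+1) 0^p`: the complete H-type strings ending with `p`. -/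
def completeHType (p : ℕ) (c : Bool) : List Bool :=
  (List.range (2 * p + 2)).flatMap (fun i => List.replicate (i + 1) (if Even i then c else !c))
    ++ List.replicate (p + 1) c ++ List.replicate p false

/-- `μ, ν` is a pair of H-type strings ending with `p` of length `n`: the two suffixes of length `n`
of the two complete H-type strings ending with `p` (in either order). -/
def IsHTypePair {n : ℕ} (p : ℕ) (μ ν : Fin n → Bool) : Prop :=
  (List.ofFn μ <:+ completeHType p true ∧ List.ofFn ν <:+ completeHType p false) ∨
  (List.ofFn μ <:+ completeHType p false ∧ List.ofFn ν <:+ completeHType p true)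

/-- The data of a distance-barrier: the number `pre` of coordinates in front of it, the thickness
`first = r_1` of its first barrier, and the list `rest = [(s_1, r_2), …, (s_t, r_(t+1))]`. -/
structure Barrier where
  pre : ℕ
  first : ℕ
  rest : List (ℕ × ℕ)

namespace Barrier

/-- The word `1^(r_1) 0^(s_1) 1^(r_2) ⋯ 0^(s_t) 1^(r_(t+1))`. -/
def brokenRow (D : Barrier) : List Bool :=
  List.replicate D.first true ++
    D.rest.flatMap (fun q => List.replicate q.1 false ++ List.replicate q.2 true)

/-- The length of the distance-barrier. -/
def length (D : Barrier) : ℕ := D.brokenRow.length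

/-- The word `1^(r_1) 1^(s_1) 1^(r_2) ⋯ 1^(s_t) 1^(r_(t+1))`. -/
def fullRow (D : Barrier) : List Bool := List.replicate D.length true

/-- The coordinates (numbered from `0`) occupied by the distance-barrier. -/
def positions (D : Barrier) : Finset ℕ := Finset.Ico D.pre (D.pre + D.length)

/-- The thicknesses `[r_1, …, r_(t+1)]` of the barriers. -/
def thicknesses (D : Barrier) : List ℕ := D.first :: D.rest.map Prod.snd

/-- `M`, the maximum thickness. -/
def M (D : Barrier) : ℕ := D.thicknesses.foldr max 0

/-- `C`, the sum of the thicknesses of all barriers except one barrier of maximum thickness. -/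
def C (D : Barrier) : ℕ := (D.thicknesses.erase D.M).sum

/-- `C'`, the sum of the thicknesses of all barriers. -/
def C' (D : Barrier) : ℕ := D.thicknesses.sum

end Barrier

/-- The word `w` is the factor of `x` that is preceded by exactly `k` letters. -/
def FactorAt (w x : List Bool) (k : ℕ) : Prop :=
  ∃ u v : List Bool, x = u ++ w ++ v ∧ u.length = k

/-- `D` is a distance-barrier between `a` and `b`: all `r_i, s_i` are positive, `t ≥ 1`, one of the
strings carries the broken row and the other one the full row at the same place, and a coordinate
directly in front of or behind the two factors, if there is one, is not `1` in both strings. -/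
def IsDistanceBarrier {n : ℕ} (a b : Fin n → Bool) (D : Barrier) : Prop :=
  D.rest ≠ [] ∧ (∀ r ∈ D.thicknesses, 0 < r) ∧ (∀ q ∈ D.rest, 0 < q.1) ∧
  ((FactorAt D.brokenRow (List.ofFn a) D.pre ∧ FactorAt D.fullRow (List.ofFn b) D.pre) ∨
    (FactorAt D.brokenRow (List.ofFn b) D.pre ∧ FactorAt D.fullRow (List.ofFn a) D.pre)) ∧
  ∀ i : Fin n, ((i : ℕ) + 1 = D.pre ∨ (i : ℕ) = D.pre + D.length) →
    ¬ (a i = true ∧ b i = true)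

/-- A distance-barrier that is not properly contained in another one. These are the ones that are
counted when the distance-barriers between two strings are listed. -/
def IsMaximalDistanceBarrier {n : ℕ} (a b : Fin n → Bool) (D : Barrier) : Prop :=
  IsDistanceBarrier a b D ∧
    ¬ ∃ D', IsDistanceBarrier a b D' ∧ D.positions ⊂ D'.positions

/-- `α, β` is a pair of NH-type strings obtained from `μ, ν` by inserting distance-barriers: they
have a common `0` exactly where `μ, ν` have one, and wherever they have a common `1`, this `1`
belongs to one of the barriers of exactly one (maximal) distance-barrier between them. -/
def IsNHTypePair {n : ℕ} (μ ν α β : Fin n → Bool) : Prop :=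
  (∀ i, (α i = false ∧ β i = false) ↔ (μ i = false ∧ ν i = false)) ∧
  ∀ i : Fin n, α i = true → β i = true →
    ∃! D : Barrier, IsMaximalDistanceBarrier α β D ∧ (i : ℕ) ∈ D.positions

end FibRun

namespace FibRun

/-! Identify a string with its set of ones. The distance between two vertices is `|x| + |y|` minus
twice the largest number of common ones that a walk can leave untouched; when every common one lies
in exactly one maximal distance-barrier, that number is `∑ M_k`.

Lower bound (`le_dist_add_sum`): a common one is either never flipped or flipped at least twice.
Since `101` cannot occur in a vertex, one step cannot make or break a block of ones whose two ends
it leaves fixed (`Icc_subset_ones_of_adj`). Inside a barrier one string is all ones, so two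
untouched ones must be joined by ones in the other string too. Hence they lie in a single block, and
at most `M` of them survive.

Upper bound (`dist_add_sum_le`): keep one thickest block `G_k` of each barrier and delete all other
ones from the ends of runs. This works because kept ones in the same run belong to the same barrier
(`eq_of_Icc_subset_ones`).

For `μ, ν` there are no common ones, so their distance is `|μ ∪ ν| = |α ∪ β| = |α| + |β| - |α ∩ β|`.
Since the maximal barriers partition the common ones, `|α ∩ β| = ∑ C'_k`, and the formula follows.
-/

/-! ### Supports of strings and runs of ones -/

/-- The set of coordinates at which a binary string is `1`. -/
def ones {n : ℕ} (x : Fin n → Bool) : Finset ℕ :=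
  (Finset.univ.filter (fun i => x i = true)).map Fin.valEmbedding

theorem mem_ones {n : ℕ} {x : Fin n → Bool} {i : ℕ} :
    i ∈ ones x ↔ ∃ h : i < n, x ⟨i, h⟩ = true := by
  simp only [ones, Finset.mem_map, Finset.mem_filter, Finset.mem_univ, true_and,
    Fin.valEmbedding_apply]
  constructor
  · rintro ⟨j, hj, rfl⟩
    exact ⟨j.2, hj⟩
  · rintro ⟨h, hx⟩
    exact ⟨⟨i, h⟩, hx, rfl⟩

theorem coe_mem_ones {n : ℕ} {x : Fin n → Bool} {i : Fin n} :
    (i : ℕ) ∈ ones x ↔ x i = true := by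
  rw [mem_ones]
  exact ⟨fun ⟨_, h⟩ => h, fun h => ⟨i.2, h⟩⟩

theorem mem_ones_iff_getElem? {n : ℕ} {x : Fin n → Bool} {i : ℕ} :
    i ∈ ones x ↔ (List.ofFn x)[i]? = some true := by
  rw [mem_ones, List.getElem?_eq_some_iff]
  simp

theorem lt_of_mem_ones {n : ℕ} {x : Fin n → Bool} {i : ℕ} (h : i ∈ ones x) : i < n :=
  (mem_ones.1 h).1

theorem ones_injective {n : ℕ} : Function.Injective (ones (n := n)) := by
  intro x y h
  funext i
  rw [Bool.eq_iff_iff, ← coe_mem_ones, ← coe_mem_ones, h]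

theorem mem_ones_iff_padded {n : ℕ} {x : Fin n → Bool} {i : ℕ} :
    i ∈ ones x ↔ (List.ofFn x ++ [false, false])[i]? = some true := by
  rw [mem_ones_iff_getElem?, List.getElem?_append]
  split
  · rfl
  · rename_i h
    rw [List.getElem?_eq_none (by simpa using h)]
    rcases i - (List.ofFn x).length with _ | _ | k <;> simp

theorem exists_run_start (s : Finset ℕ) {a b : ℕ} (hab : a < b)
    (h : ∀ i, a ≤ i → i < b → i ∈ s) :
    ∃ c ≤ a, (∀ i, c ≤ i → i < b → i ∈ s) ∧ (c = 0 ∨ c - 1 ∉ s) := by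
  induction a with
  | zero => exact ⟨0, le_rfl, h, Or.inl rfl⟩
  | succ a ih =>
    by_cases ha : a ∈ s
    · obtain ⟨c, hc, hc'⟩ := ih (by omega) (fun i hi hib => by
        rcases hi.eq_or_lt with rfl | hi
        · exact ha
        · exact h i hi hib)
      exact ⟨c, by omega, hc'⟩
    · exact ⟨a + 1, le_rfl, h, Or.inr (by simpa using ha)⟩

theorem exists_run_end (s : Finset ℕ) {a b : ℕ} (hab : a ≤ b)
    (h : ∀ i, a ≤ i → i ≤ b → i ∈ s) :
    ∃ c ≥ b, (∀ i, a ≤ i → i ≤ c → i ∈ s) ∧ c + 1 ∉ s := by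
  have hex : ∃ d, b + d + 1 ∉ s := by
    obtain ⟨m, hm⟩ := s.bddAbove
    exact ⟨m, fun hmem => by have := hm hmem; omega⟩
  classical
  refine ⟨b + Nat.find hex, by omega, fun i hi hic => ?_, Nat.find_spec hex⟩
  by_cases hib : i ≤ b
  · exact h i hi hib
  · have := Nat.find_min hex (m := i - b - 1) (by omega)
    rw [not_not] at this
    convert this using 1
    omega

/-- Only the right end of the run has to be maximal: extending `[a, b)` to the left only strengthens
the conclusion. The bound `n + 1` is the last index of the word padded by two zeros. -/
theorem runConstrained_iff {n : ℕ} (x : Fin n → Bool) :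
    RunConstrained (List.ofFn x ++ [false, false]) ↔
      ∀ a b, a < b → (∀ i, a ≤ i → i < b → i ∈ ones x) → b ∉ ones x →
        b + (b - a) ≤ n + 1 ∧ ∀ j, b ≤ j → j ≤ b + (b - a) → j ∉ ones x := by
  have hlen : (List.ofFn x ++ [false, false]).length = n + 2 := by simp
  have hmem : ∀ i, i ∈ ones x ↔ (List.ofFn x ++ [false, false])[i]? = some true :=
    fun i => mem_ones_iff_padded
  generalize List.ofFn x ++ [false, false] = w at hlen hmem
  constructor
  · intro hw a b hab h1 hb
    obtain ⟨c, hca, hc, hc0⟩ := exists_run_start _ hab h1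
    have hbn : b ≤ n := lt_of_mem_ones (h1 (b - 1) (by omega) (by omega)) |> fun h => by omega
    have hp := hw (w.take c) (w.drop b) (b - c) (by omega) (by
        apply List.ext_getElem?
        intro i
        rw [List.append_assoc, List.getElem?_append, List.getElem?_append]
        simp only [List.length_take, List.length_replicate, List.getElem?_take,
          List.getElem?_replicate, List.getElem?_drop, hlen]
        split_ifs with h1 h2 h3
        · rfl
        · omega
        · rw [← hmem]; exact hc i (by omega) (by omega)
        · congr 1; omega) (by
        rw [List.getLast?_eq_getElem?, List.length_take, hlen]
        rcases hc0 with rfl | hc0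
        · simp
        · rw [hmem] at hc0
          rcases Nat.eq_zero_or_pos c with rfl | hpos
          · simp
          · rw [List.getElem?_take, if_pos (by omega)]
            convert hc0 using 3
            omega) (by
        rw [List.head?_drop, Ne, ← hmem]; exact hb)
    have hz : ∀ j, j < b - c + 1 → w[b + j]? = some false := by
      intro j hj
      rw [← List.getElem?_drop, List.prefix_iff_getElem?.1 hp j (by simpa using hj)]
      simp
    constructor
    · have := (List.getElem?_eq_some_iff.1 (hz (b - c) (by omega))).1
      omega
    · intro j hbj hj
      rw [hmem, show j = b + (j - b) by omega, hz _ (by omega)]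
      simp
  · intro h u v r hr hw _ hv
    have hw' : ∀ i : ℕ, w[i]? = (u ++ (List.replicate r true ++ v))[i]? := by
      intro i; rw [hw, List.append_assoc]
    have hvget : ∀ j : ℕ, v[j]? = w[u.length + r + j]? := by
      intro j
      rw [hw', List.getElem?_append_right (by omega), List.getElem?_append_right (by simp; omega)]
      rw [List.length_replicate, show u.length + r + j - u.length - r = j by omega]
    obtain ⟨h2, h3⟩ := h u.length (u.length + r) (by omega) (fun i hi hir => by
      rw [hmem, hw', List.getElem?_append_right hi, List.getElem?_append_left (by simp; omega),
        List.getElem?_replicate, if_pos (by omega)]) (by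
      rw [hmem]
      rw [List.head?_eq_getElem?, hvget] at hv
      exact hv)
    rw [List.prefix_iff_getElem?]
    intro j hj
    simp only [List.length_replicate] at hj
    have h4 := h3 (u.length + r + j) (by omega) (by omega)
    rw [hmem] at h4
    rw [hvget, List.getElem_replicate]
    rw [List.getElem?_eq_getElem (by omega)] at h4 ⊢
    simpa using h4

theorem Vertex.zeros_after_run {n : ℕ} (x : Vertex n) {a b : ℕ} (hab : a < b)
    (h : ∀ i, a ≤ i → i < b → i ∈ ones x.1) (hb : b ∉ ones x.1) :
    b + (b - a) ≤ n + 1 ∧ ∀ j, b ≤ j → j ≤ b + (b - a) → j ∉ ones x.1 :=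
  (runConstrained_iff x.1).1 x.2 a b hab h hb

theorem card_filter_getElem?_eq_count (l : List Bool) :
    ((Finset.range l.length).filter (fun j => l[j]? = some true)).card = l.count true := by
  induction l using List.reverseRecOn with
  | nil => simp
  | append_singleton l c ih =>
    have h1 : (Finset.range (l ++ [c]).length).filter (fun j => (l ++ [c])[j]? = some true) =
        if c = true then
          insert l.length ((Finset.range l.length).filter (fun j => l[j]? = some true))
        else (Finset.range l.length).filter (fun j => l[j]? = some true) := by
      have h2 : (Finset.range l.length).filter (fun j => (l ++ [c])[j]? = some true) =
          (Finset.range l.length).filter (fun j => l[j]? = some true) := by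
        apply Finset.filter_congr
        intro j hj
        rw [List.getElem?_append_left (by simpa using hj)]
      rw [List.length_append, List.length_singleton, Finset.range_add_one, Finset.filter_insert, h2]
      simp
    rw [h1, List.count_append, ← ih]
    cases c
    · simp
    · simp

/-! ### The word of a single barrier -/

namespace Barrier

theorem brokenRow_cons (k r s t : ℕ) (q : List (ℕ × ℕ)) :
    brokenRow ⟨k, r, (s, t) :: q⟩ =
      List.replicate r true ++ (List.replicate s false ++ brokenRow ⟨k, t, q⟩) := by
  simp [brokenRow]

theorem count_brokenRow (D : Barrier) : D.brokenRow.count true = D.C' := by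
  obtain ⟨k, r, q⟩ := D
  induction q generalizing r with
  | nil => simp [brokenRow, C', thicknesses]
  | cons st q ih =>
    obtain ⟨s, t⟩ := st
    rw [brokenRow_cons, List.count_append, List.count_append, ih]
    simp [C', thicknesses, List.count_replicate]

theorem le_M {D : Barrier} {t : ℕ} (ht : t ∈ D.thicknesses) : t ≤ D.M := by
  unfold M
  generalize D.thicknesses = l at ht
  induction l with
  | nil => exact absurd ht List.not_mem_nil
  | cons a l ih =>
    rcases List.mem_cons.1 ht with rfl | h
    · simp
    · exact (ih h).trans (by simp)

theorem M_mem (D : Barrier) : D.M ∈ D.thicknesses := by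
  have key : ∀ (l : List ℕ) (a : ℕ), (a :: l).foldr max 0 ∈ a :: l := by
    intro l
    induction l with
    | nil => intro a; simp
    | cons b l ih =>
      intro a
      rw [List.foldr_cons]
      rcases max_choice a ((b :: l).foldr max 0) with h | h <;> rw [h]
      · simp
      · exact List.mem_cons_of_mem _ (ih b)
  exact key _ _

theorem C_add_M (D : Barrier) : D.C + D.M = D.C' := by
  have := (List.perm_cons_erase D.M_mem).sum_eq
  rw [List.sum_cons] at this
  unfold C C'
  omega

theorem exists_block {D : Barrier} {t : ℕ} (ht : t ∈ D.thicknesses) :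
    ∃ u v, D.brokenRow = u ++ List.replicate t true ++ v := by
  obtain ⟨k, r, q⟩ := D
  induction q generalizing r with
  | nil =>
    obtain rfl : t = r := by simpa [thicknesses] using ht
    exact ⟨[], [], by simp [brokenRow]⟩
  | cons st q ih =>
    obtain ⟨s, t'⟩ := st
    rw [brokenRow_cons]
    rcases List.mem_cons.1 ht with rfl | h
    · exact ⟨[], _, rfl⟩
    · obtain ⟨u, v, huv⟩ := ih t' h
      exact ⟨List.replicate r true ++ (List.replicate s false ++ u), v, by simp [huv]⟩

theorem sub_le_M (D : Barrier) (hs : ∀ q ∈ D.rest, 0 < q.1) {a b : ℕ}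
    (h : ∀ i, a ≤ i → i < b → D.brokenRow[i]? = some true) : b - a ≤ D.M := by
  rcases le_or_gt b a with hab | hab
  · omega
  obtain ⟨k, r, q⟩ := D
  induction q generalizing r a b with
  | nil =>
    have := h (b - 1) (by omega) (by omega)
    have h2 := (List.getElem?_eq_some_iff.1 this).1
    have h3 : r ≤ M ⟨k, r, []⟩ := le_M (by simp [thicknesses])
    simp [brokenRow] at h2
    omega
  | cons st q ih =>
    obtain ⟨s, t⟩ := st
    have hs0 : 0 < s := hs (s, t) (by simp)
    have hM : M ⟨k, r, (s, t) :: q⟩ = max r (M ⟨k, t, q⟩) := by simp [M, thicknesses]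
    rw [brokenRow_cons] at h
    have hz : ∀ i, r ≤ i → i < r + s → ¬ (a ≤ i ∧ i < b) := by
      rintro i hi his ⟨h1, h2⟩
      have := h i h1 h2
      rw [List.getElem?_append_right (by simpa using hi),
        List.getElem?_append_left (by simp; omega), List.getElem?_replicate] at this
      split_ifs at this
      simp at this
    -- An interval of ones cannot meet the first gap, so it lies in the first block or entirely
    -- beyond the gap.
    by_cases hbr : b ≤ r
    · have := le_max_left r (M ⟨k, t, q⟩)
      omega
    · have har : r + s ≤ a := by
        by_contra hcon
        have h1 := hz r le_rfl (by omega)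
        have h2 := hz a
        omega
      have := ih (a := a - (r + s)) (b := b - (r + s)) (r := t) (by omega)
        (fun q' hq' => hs q' (List.mem_cons_of_mem _ hq')) (fun i hi hib => by
          have := h (i + (r + s)) (by omega) (by omega)
          rw [List.getElem?_append_right (by simp; omega),
            List.getElem?_append_right (by simp; omega)] at this
          simp only [List.length_replicate] at this
          convert this using 2
          omega)
      have := le_max_right r (M ⟨k, t, q⟩)
      omega

/-- The first thickness may be `0` here, so that letters can be prepended one at a time: a zero then
either lengthens the leading gap or opens a new one. -/
theorem exists_eq_brokenRow_aux (w : List Bool) (hw : w ≠ [] → w.getLast? = some true) (k : ℕ) :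
    ∃ r q, (∀ st ∈ q, 0 < st.1 ∧ 0 < st.2) ∧ w = brokenRow ⟨k, r, q⟩ := by
  induction w with
  | nil => exact ⟨0, [], by simp, by simp [brokenRow]⟩
  | cons c w ih =>
    obtain ⟨r, q, hq, rfl⟩ := ih (fun h => by
      have := hw (by simp)
      rwa [List.getLast?_cons_of_ne_nil h] at this)
    cases c
    · rcases Nat.eq_zero_or_pos r with rfl | hr
      · rcases q with _ | ⟨⟨s, t⟩, q⟩
        · simp [brokenRow] at hw
        · refine ⟨0, (s + 1, t) :: q, ?_, ?_⟩
          · intro st hst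
            rcases List.mem_cons.1 hst with rfl | h
            · exact ⟨Nat.succ_pos _, (hq (s, t) (by simp)).2⟩
            · exact hq st (List.mem_cons_of_mem _ h)
          · rw [brokenRow_cons, brokenRow_cons]
            simp [List.replicate_succ]
      · refine ⟨0, (1, r) :: q, ?_, ?_⟩
        · intro st hst
          rcases List.mem_cons.1 hst with rfl | h
          · exact ⟨one_pos, hr⟩
          · exact hq st h
        · rw [brokenRow_cons]
          simp
    · exact ⟨r + 1, q, hq, by simp [brokenRow, List.replicate_succ]⟩

theorem exists_eq_brokenRow (w : List Bool) (hhead : w.head? = some true)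
    (hlast : w.getLast? = some true) (hfalse : false ∈ w) (k : ℕ) :
    ∃ D : Barrier, D.pre = k ∧ D.rest ≠ [] ∧ (∀ r ∈ D.thicknesses, 0 < r) ∧
      (∀ q ∈ D.rest, 0 < q.1) ∧ D.brokenRow = w := by
  obtain ⟨r, q, hq, rfl⟩ := exists_eq_brokenRow_aux w (fun _ => hlast) k
  have hne : q ≠ [] := by
    rintro rfl
    simp [brokenRow] at hfalse
  have hr : 0 < r := by
    rcases Nat.eq_zero_or_pos r with rfl | hr
    · obtain ⟨⟨s, t⟩, q', rfl⟩ := List.exists_cons_of_ne_nil hne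
      have hs := (hq (s, t) (by simp)).1
      obtain ⟨s, rfl⟩ : ∃ s', s = s' + 1 := ⟨s - 1, by omega⟩
      rw [brokenRow_cons] at hhead
      simp [List.replicate_succ] at hhead
    · exact hr
  refine ⟨⟨k, r, q⟩, rfl, hne, ?_, fun st hst => (hq st hst).1, rfl⟩
  intro t ht
  rcases List.mem_cons.1 ht with rfl | h
  · exact hr
  · obtain ⟨st, hst, rfl⟩ := List.mem_map.1 h
    exact (hq st hst).2

end Barrier

/-! ### Distance-barriers and common ones -/

theorem FactorAt.getElem? {w x : List Bool} {k : ℕ} (h : FactorAt w x k) {j : ℕ}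
    (hj : j < w.length) : x[k + j]? = w[j]? := by
  obtain ⟨u, v, rfl, rfl⟩ := h
  rw [List.append_assoc, List.getElem?_append_right (by omega), List.getElem?_append_left (by omega)]
  congr 1
  omega

theorem factorAt_take_drop (x : List Bool) {k l : ℕ} (h : k + l ≤ x.length) :
    FactorAt ((x.drop k).take l) x k :=
  ⟨x.take k, x.drop (k + l), by
    rw [List.append_assoc, ← List.drop_drop, List.take_append_drop, List.take_append_drop],
    by simp; omega⟩

section

variable {n : ℕ} {a b : Fin n → Bool} {D : Barrier}

theorem IsDistanceBarrier.symm (h : IsDistanceBarrier a b D) : IsDistanceBarrier b a D :=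
  ⟨h.1, h.2.1, h.2.2.1, h.2.2.2.1.symm, fun i hi hab => h.2.2.2.2 i hi hab.symm⟩

theorem mem_ones_of_factorAt_fullRow (h : FactorAt D.fullRow (List.ofFn a) D.pre) {i : ℕ}
    (hi : i ∈ D.positions) : i ∈ ones a := by
  rw [Barrier.positions, Finset.mem_Ico] at hi
  have := h.getElem? (j := i - D.pre) (by simp [Barrier.fullRow]; omega)
  rw [mem_ones_iff_getElem?, show i = D.pre + (i - D.pre) by omega, this]
  rw [Barrier.fullRow, List.getElem?_replicate, if_pos (by omega)]

theorem mem_ones_iff_of_factorAt_brokenRow (h : FactorAt D.brokenRow (List.ofFn a) D.pre) {i : ℕ}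
    (hi : i ∈ D.positions) : i ∈ ones a ↔ D.brokenRow[i - D.pre]? = some true := by
  rw [Barrier.positions, Finset.mem_Ico, Barrier.length] at hi
  rw [← h.getElem? (j := i - D.pre) (by omega), mem_ones_iff_getElem?]
  rw [show D.pre + (i - D.pre) = i by omega]

theorem IsDistanceBarrier.full (h : IsDistanceBarrier a b D) :
    D.positions ⊆ ones a ∨ D.positions ⊆ ones b := by
  rcases h.2.2.2.1 with ⟨-, h⟩ | ⟨-, h⟩
  · exact Or.inr fun i hi => mem_ones_of_factorAt_fullRow h hi
  · exact Or.inl fun i hi => mem_ones_of_factorAt_fullRow h hi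

theorem IsDistanceBarrier.mem_common_iff (h : IsDistanceBarrier a b D) {i : ℕ}
    (hi : i ∈ D.positions) :
    i ∈ ones a ∩ ones b ↔ D.brokenRow[i - D.pre]? = some true := by
  rw [Finset.mem_inter]
  rcases h.2.2.2.1 with ⟨h1, h2⟩ | ⟨h1, h2⟩
  · rw [mem_ones_iff_of_factorAt_brokenRow h1 hi]
    exact and_iff_left (mem_ones_of_factorAt_fullRow h2 hi)
  · rw [mem_ones_iff_of_factorAt_brokenRow h1 hi]
    exact and_iff_right (mem_ones_of_factorAt_fullRow h2 hi)

theorem IsDistanceBarrier.card_common (h : IsDistanceBarrier a b D) :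
    (D.positions.filter (· ∈ ones a ∩ ones b)).card = D.C' := by
  rw [← D.count_brokenRow, ← card_filter_getElem?_eq_count]
  symm
  apply Finset.card_bij (fun j _ => D.pre + j)
  · intro j hj
    rw [Finset.mem_filter, Finset.mem_range] at hj
    have hp : D.pre + j ∈ D.positions := by
      rw [Barrier.positions, Finset.mem_Ico, Barrier.length]; omega
    rw [Finset.mem_filter, h.mem_common_iff hp]
    exact ⟨hp, by simpa using hj.2⟩
  · intro i _ j _ hij
    omega
  · intro i hi
    rw [Finset.mem_filter] at hi
    have h2 := (h.mem_common_iff hi.1).1 hi.2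
    have h3 := hi.1
    rw [Barrier.positions, Finset.mem_Ico, Barrier.length] at h3
    exact ⟨i - D.pre, by rw [Finset.mem_filter, Finset.mem_range]; exact ⟨by omega, h2⟩, by omega⟩

theorem IsDistanceBarrier.exists_block (h : IsDistanceBarrier a b D) :
    ∃ c, ∀ i ∈ Finset.Ico c (c + D.M), i ∈ D.positions ∧ i ∈ ones a ∩ ones b := by
  obtain ⟨u, v, huv⟩ := Barrier.exists_block D.M_mem
  have hlen : D.length = u.length + D.M + v.length := by
    rw [Barrier.length, huv]; simp; omega
  refine ⟨D.pre + u.length, fun i hi => ?_⟩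
  rw [Finset.mem_Ico] at hi
  have hp : i ∈ D.positions := by
    rw [Barrier.positions, Finset.mem_Ico]; omega
  refine ⟨hp, (h.mem_common_iff hp).2 ?_⟩
  rw [huv, List.append_assoc, List.getElem?_append_right (by omega),
    List.getElem?_append_left (by simp; omega), List.getElem?_replicate, if_pos (by omega)]

theorem IsDistanceBarrier.card_le_M (h : IsDistanceBarrier a b D) {S : Finset ℕ}
    (hS : S ⊆ D.positions)
    (hconv : ∀ i ∈ S, ∀ j ∈ S, i ≤ j → Finset.Icc i j ⊆ ones a ∩ ones b) : S.card ≤ D.M := by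
  rcases S.eq_empty_or_nonempty with rfl | hne
  · simp
  have hmin := S.min'_mem hne
  have hmax := S.max'_mem hne
  have hle : S.min' hne ≤ S.max' hne := S.min'_le _ hmax
  have hsub : S ⊆ Finset.Icc (S.min' hne) (S.max' hne) := fun i hi =>
    Finset.mem_Icc.2 ⟨S.min'_le _ hi, S.le_max' _ hi⟩
  have hcard := Finset.card_le_card hsub
  have h1 := hS hmin
  have h2 := hS hmax
  rw [Barrier.positions, Finset.mem_Ico] at h1 h2
  have := D.sub_le_M h.2.2.1 (a := S.min' hne - D.pre) (b := S.max' hne + 1 - D.pre)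
    (fun i hi hib => by
      have hp : D.pre + i ∈ D.positions := by
        rw [Barrier.positions, Finset.mem_Ico]; omega
      have := (h.mem_common_iff hp).1
        (hconv _ hmin _ hmax hle (Finset.mem_Icc.2 ⟨by omega, by omega⟩))
      simpa using this)
  rw [Nat.card_Icc] at hcard
  omega

/-- A block of common ones crossing an edge of the barrier would contain the coordinate just outside
it, which is not a common one. -/
theorem IsDistanceBarrier.mem_positions_of_Icc (h : IsDistanceBarrier a b D) {i j : ℕ}
    (hij : i ≤ j) (hc : Finset.Icc i j ⊆ ones a ∩ ones b) :
    i ∈ D.positions ↔ j ∈ D.positions := by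
  have key : ∀ e ∈ Finset.Icc i j, ¬ (e + 1 = D.pre ∨ e = D.pre + D.length) := by
    intro e he hcon
    have h1 := Finset.mem_inter.1 (hc he)
    have hn := lt_of_mem_ones h1.1
    exact h.2.2.2.2 ⟨e, hn⟩ hcon ⟨coe_mem_ones.1 h1.1, coe_mem_ones.1 h1.2⟩
  have k1 := key (D.pre - 1)
  have k2 := key (D.pre + D.length)
  rw [Finset.mem_Icc] at k1 k2
  rw [Barrier.positions, Finset.mem_Ico, Finset.mem_Ico]
  omega

/-- Extend `i` to the left and `j` to the right through common ones as far as possible. Stopping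
there gives the edge conditions, and the zero at `e` ensures at least two barriers. -/
theorem exists_isDistanceBarrier {i j e : ℕ} (hie : i ≤ e) (hej : e ≤ j)
    (ha : Finset.Icc i j ⊆ ones a) (hi : i ∈ ones b) (hj : j ∈ ones b) (he : e ∉ ones b) :
    ∃ D, IsDistanceBarrier a b D ∧ i ∈ D.positions ∧ j ∈ D.positions := by
  have hia : i ∈ ones a := ha (Finset.mem_Icc.2 ⟨le_rfl, by omega⟩)
  have hja : j ∈ ones a := ha (Finset.mem_Icc.2 ⟨by omega, le_rfl⟩)
  obtain ⟨c, hci, hc, hc0⟩ := exists_run_start (ones a ∩ ones b) (Nat.lt_succ_self i)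
    (fun k h1 h2 => by
      obtain rfl : k = i := by omega
      exact Finset.mem_inter.2 ⟨hia, hi⟩)
  obtain ⟨d, hdj, hd, hd0⟩ := exists_run_end (ones a ∩ ones b) (le_refl j)
    (fun k h1 h2 => by
      obtain rfl : k = j := by omega
      exact Finset.mem_inter.2 ⟨hja, hj⟩)
  have hcd : ∀ k, c ≤ k → k ≤ d → k ∈ ones a := by
    intro k h1 h2
    by_cases hki : k ≤ i
    · exact (Finset.mem_inter.1 (hc k h1 (by omega))).1
    by_cases hkj : k ≤ j
    · exact ha (Finset.mem_Icc.2 ⟨by omega, hkj⟩)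
    · exact (Finset.mem_inter.1 (hd k (by omega) h2)).1
  have hdn := lt_of_mem_ones (hcd d (by omega) le_rfl)
  have hcb := (Finset.mem_inter.1 (hc c le_rfl (by omega))).2
  have hdb := (Finset.mem_inter.1 (hd d hdj le_rfl)).2
  have hlen : (((List.ofFn b).drop c).take (d + 1 - c)).length = d + 1 - c := by
    simp; omega
  have hget : ∀ k, k < d + 1 - c →
      (((List.ofFn b).drop c).take (d + 1 - c))[k]? = (List.ofFn b)[c + k]? := by
    intro k hk
    rw [List.getElem?_take, if_pos hk, List.getElem?_drop]
  obtain ⟨D, hpre, hrest, hth, hs, hrow⟩ := Barrier.exists_eq_brokenRow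
    (((List.ofFn b).drop c).take (d + 1 - c))
    (by
      rw [List.head?_eq_getElem?, hget _ (by omega), ← mem_ones_iff_getElem?]
      exact hcb)
    (by
      rw [List.getLast?_eq_getElem?, hlen, hget _ (by omega), ← mem_ones_iff_getElem?]
      rwa [show c + (d + 1 - c - 1) = d by omega])
    (by
      rw [List.mem_iff_getElem?]
      refine ⟨e - c, ?_⟩
      rw [hget _ (by omega), show c + (e - c) = e by omega]
      rw [mem_ones_iff_getElem?] at he
      rw [List.getElem?_eq_getElem (by simp; omega)] at he ⊢
      simpa using he) c
  have hDlen : D.length = d + 1 - c := by rw [Barrier.length, hrow, hlen]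
  have hfull : FactorAt D.fullRow (List.ofFn a) D.pre := by
    have hcn : c + (d + 1 - c) ≤ (List.ofFn a).length := by simp; omega
    have h2 := factorAt_take_drop (List.ofFn a) hcn
    rw [hpre]
    convert h2 using 1
    apply List.ext_getElem?
    intro k
    rw [Barrier.fullRow, hDlen, List.getElem?_replicate, List.getElem?_take]
    split_ifs with h
    · rw [List.getElem?_drop, eq_comm, ← mem_ones_iff_getElem?]
      exact hcd _ (by omega) (by omega)
    · rfl
  refine ⟨D, ⟨hrest, hth, hs, Or.inr ⟨?_, hfull⟩, ?_⟩, ?_, ?_⟩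
  · rw [hrow, hpre]
    exact factorAt_take_drop _ (by simp; omega)
  · rintro k hk ⟨hka, hkb⟩
    have hmem : (k : ℕ) ∈ ones a ∩ ones b :=
      Finset.mem_inter.2 ⟨coe_mem_ones.2 hka, coe_mem_ones.2 hkb⟩
    rw [hDlen, hpre] at hk
    rcases hk with hk | hk
    · rcases hc0 with hc0 | hc0
      · omega
      · exact hc0 (by rwa [show c - 1 = (k : ℕ) by omega])
    · exact hd0 (by rwa [show d + 1 = (k : ℕ) by omega])
  · rw [Barrier.positions, Finset.mem_Ico]; omega
  · rw [Barrier.positions, Finset.mem_Ico]; omega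

theorem IsDistanceBarrier.positions_subset (h : IsDistanceBarrier a b D) :
    D.positions ⊆ Finset.range n := by
  intro i hi
  rw [Finset.mem_range]
  rcases h.full with h | h
  · exact lt_of_mem_ones (h hi)
  · exact lt_of_mem_ones (h hi)

theorem IsDistanceBarrier.exists_isMaximal (h : IsDistanceBarrier a b D) :
    ∃ D', IsMaximalDistanceBarrier a b D' ∧ D.positions ⊆ D'.positions := by
  induction hk : n - D.positions.card using Nat.strong_induction_on generalizing D with
  | _ k ih =>
    by_cases hmax : IsMaximalDistanceBarrier a b D
    · exact ⟨D, hmax, subset_rfl⟩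
    · rw [IsMaximalDistanceBarrier, not_and, not_not] at hmax
      obtain ⟨D', hD', hlt⟩ := hmax h
      have h1 := Finset.card_lt_card hlt
      have h2 := Finset.card_le_card hD'.positions_subset
      rw [Finset.card_range] at h2
      obtain ⟨D'', h3, h4⟩ := ih _ (by omega) hD' rfl
      exact ⟨D'', h3, hlt.subset.trans h4⟩

/-- If every common `1` lies in exactly one maximal distance-barrier, then two common `1`s in the
same run of one of the strings lie in the same maximal distance-barrier. -/
theorem eq_of_Icc_subset_ones
    (huniq : ∀ i ∈ ones a ∩ ones b, ∃! D, IsMaximalDistanceBarrier a b D ∧ i ∈ D.positions)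
    {i j : ℕ} (hij : i ≤ j) (h : Finset.Icc i j ⊆ ones a ∨ Finset.Icc i j ⊆ ones b)
    (hi : i ∈ ones a ∩ ones b) (hj : j ∈ ones a ∩ ones b) {D₁ D₂ : Barrier}
    (h₁ : IsMaximalDistanceBarrier a b D₁) (hi₁ : i ∈ D₁.positions)
    (h₂ : IsMaximalDistanceBarrier a b D₂) (hj₂ : j ∈ D₂.positions) : D₁ = D₂ := by
  -- Either a solid block of common ones joins `i` to `j` and cannot leave a barrier, or a gap
  -- between them yields a barrier containing both.
  by_cases hc : Finset.Icc i j ⊆ ones a ∩ ones b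
  · exact (huniq j hj).unique ⟨h₁, (h₁.1.mem_positions_of_Icc hij hc).1 hi₁⟩ ⟨h₂, hj₂⟩
  · obtain ⟨e, he, hec⟩ := Finset.not_subset.1 hc
    rw [Finset.mem_inter, not_and_or] at hec
    have he' := Finset.mem_Icc.1 he
    rw [Finset.mem_inter] at hi hj
    have : ∃ D, IsDistanceBarrier a b D ∧ i ∈ D.positions ∧ j ∈ D.positions := by
      rcases h with h | h
      · exact exists_isDistanceBarrier he'.1 he'.2 h hi.2 hj.2
          (hec.resolve_left (not_not.2 (h he)))
      · obtain ⟨D, hD, hpos⟩ := exists_isDistanceBarrier he'.1 he'.2 h hi.1 hj.1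
          (hec.resolve_right (not_not.2 (h he)))
        exact ⟨D, hD.symm, hpos⟩
    obtain ⟨D, hD, hiD, hjD⟩ := this
    obtain ⟨D', hD', hsub⟩ := hD.exists_isMaximal
    rw [← Finset.mem_inter] at hi hj
    exact ((huniq i hi).unique ⟨h₁, hi₁⟩ ⟨hD', hsub hiD⟩).trans
      ((huniq j hj).unique ⟨hD', hsub hjD⟩ ⟨h₂, hj₂⟩)

end

/-! ### Walks that only delete ones -/

section

variable {n : ℕ}

/-- Removing an end of a run shortens it without shortening any run of zeros, so the constraint
survives. -/
theorem Vertex.exists_erase (x : Vertex n) {z : ℕ} (hz : z ∈ ones x.1)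
    (hend : z + 1 ∉ ones x.1 ∨ z = 0 ∨ z - 1 ∉ ones x.1) :
    ∃ y : Vertex n, ones y.1 = (ones x.1).erase z ∧ (graph n).Adj x y := by
  have hzn := lt_of_mem_ones hz
  have hx := coe_mem_ones (i := ⟨z, hzn⟩).1 hz
  let y : Fin n → Bool := Function.update x.1 ⟨z, hzn⟩ false
  have hy : ones y = (ones x.1).erase z := by
    ext i
    rw [Finset.mem_erase, mem_ones, mem_ones]
    constructor
    · rintro ⟨h, hi⟩
      have hne : i ≠ z := by
        rintro rfl
        simp [y] at hi
      refine ⟨hne, h, ?_⟩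
      simpa [y, hne] using hi
    · rintro ⟨hne, h, hi⟩
      refine ⟨h, ?_⟩
      simpa [y, hne] using hi
  refine ⟨⟨y, (runConstrained_iff y).2 ?_⟩, hy, ?_⟩
  · rw [hy]
    intro a b hab h1 hb
    have h1' : ∀ i, a ≤ i → i < b → i ∈ ones x.1 := fun i hi hib => Finset.mem_of_mem_erase (h1 i hi hib)
    by_cases hbx : b ∈ ones x.1
    · obtain rfl : b = z := by
        by_contra hne
        exact hb (Finset.mem_erase.2 ⟨hne, hbx⟩)
      -- The erased one has a one on its left, so it must be the right end of its run.
      have hb1 : b + 1 ∉ ones x.1 :=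
        hend.resolve_right (not_or.2 ⟨by omega, not_not.2 (h1' (b - 1) (by omega) (by omega))⟩)
      obtain ⟨h2, h3⟩ := x.zeros_after_run (a := a) (b := b + 1) (by omega) (fun i hi hib => by
        rcases Nat.lt_succ_iff_lt_or_eq.1 hib with h | rfl
        · exact h1' i hi h
        · exact hbx) hb1
      refine ⟨by omega, fun j hbj hj hmem => ?_⟩
      rcases hbj.eq_or_lt with rfl | hlt
      · exact hb hmem
      · exact h3 j (by omega) (by omega) (Finset.mem_of_mem_erase hmem)
    · obtain ⟨h2, h3⟩ := x.zeros_after_run hab h1' hbx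
      exact ⟨h2, fun j hbj hj hmem => h3 j hbj hj (Finset.mem_of_mem_erase hmem)⟩
  · change hammingDist x.1 y = 1
    rw [hammingDist, Finset.card_eq_one]
    refine ⟨⟨z, hzn⟩, ?_⟩
    ext i
    rw [Finset.mem_filter, Finset.mem_singleton]
    by_cases hi : i = ⟨z, hzn⟩
    · subst hi
      simp [y, hx]
    · simp [y, hi]

/-- A vertex can be reduced to the indicator of `G`, removing ones only, if `G` meets every run in
a contiguous block. -/
theorem exists_walk_of_convex (G : Finset ℕ) (x : Vertex n) (hG : G ⊆ ones x.1)
    (hconv : ∀ i ∈ G, ∀ j ∈ G, Finset.Icc i j ⊆ ones x.1 → Finset.Icc i j ⊆ G) :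
    ∃ (y : Vertex n) (w : (graph n).Walk x y),
      ones y.1 = G ∧ w.length + G.card = (ones x.1).card := by
  induction hk : (ones x.1).card generalizing x with
  | zero =>
    have h0 : ones x.1 = ∅ := Finset.card_eq_zero.1 hk
    have : G = ∅ := by rwa [h0, Finset.subset_empty] at hG
    subst this
    exact ⟨x, .nil, h0, by simp⟩
  | succ k ih =>
    by_cases heq : ones x.1 = G
    · exact ⟨x, .nil, heq, by rw [← heq, hk]; simp⟩
    obtain ⟨z, hz, hzG⟩ : ∃ z ∈ ones x.1, z ∉ G := by
      by_contra! hcon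
      exact heq (Finset.Subset.antisymm hcon hG)
    obtain ⟨c, hcz, hc, hc0⟩ := exists_run_start (ones x.1) (Nat.lt_succ_self z)
      (fun k h1 h2 => by
        obtain rfl : k = z := by omega
        exact hz)
    obtain ⟨d, hzd, hd, hd0⟩ := exists_run_end (ones x.1) (le_refl z)
      (fun k h1 h2 => by
        obtain rfl : k = z := by omega
        exact hz)
    have hcd : Finset.Icc c d ⊆ ones x.1 := by
      intro k hk
      rw [Finset.mem_Icc] at hk
      rcases le_total k z with h | h
      · exact hc k hk.1 (by omega)
      · exact hd k h hk.2
    -- If both ends of the run around `z` were in `G`, convexity would force `z ∈ G`; so some end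
    -- can be deleted.
    obtain ⟨e, he, heG, hend⟩ :
        ∃ e ∈ ones x.1, e ∉ G ∧ (e + 1 ∉ ones x.1 ∨ e = 0 ∨ e - 1 ∉ ones x.1) := by
      by_cases hcG : c ∈ G
      · by_cases hdG : d ∈ G
        · exact absurd (hconv c hcG d hdG hcd (Finset.mem_Icc.2 ⟨hcz, hzd⟩)) hzG
        · exact ⟨d, hcd (Finset.mem_Icc.2 ⟨by omega, le_rfl⟩), hdG, Or.inl hd0⟩
      · exact ⟨c, hcd (Finset.mem_Icc.2 ⟨le_rfl, by omega⟩), hcG, Or.inr hc0⟩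
    obtain ⟨x', hx', hadj⟩ := x.exists_erase he hend
    obtain ⟨y, w, hy, hw⟩ := ih x'
      (by
        rw [hx']
        exact fun g hg => Finset.mem_erase.2 ⟨fun h => heG (h ▸ hg), hG hg⟩)
      (fun i hi j hj h => hconv i hi j hj (h.trans (by rw [hx']; exact Finset.erase_subset _ _)))
      (by rw [hx', Finset.card_erase_of_mem he, hk]; rfl)
    exact ⟨y, .cons hadj w, hy, by rw [SimpleGraph.Walk.length_cons]; omega⟩

theorem Vertex.ext_ones {x y : Vertex n} (h : ones x.1 = ones y.1) : x = y :=
  Subtype.ext (ones_injective h)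

theorem graph_connected (n : ℕ) : (graph n).Connected := by
  have hzero : RunConstrained (List.ofFn (fun _ : Fin n => false) ++ [false, false]) := by
    rw [runConstrained_iff]
    intro a b hab h
    have := h a le_rfl hab
    simp [mem_ones] at this
  let z : Vertex n := ⟨fun _ => false, hzero⟩
  have hz : ones z.1 = ∅ := by
    ext i
    simp [mem_ones, z]
  have key : ∀ x, (graph n).Reachable x z := by
    intro x
    obtain ⟨y, w, hy, -⟩ := exists_walk_of_convex ∅ x (by simp) (by simp)
    obtain rfl : y = z := Vertex.ext_ones (by rw [hy, hz])
    exact ⟨w⟩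
  exact { preconnected := fun x y => (key x).trans (key y).symm, nonempty := ⟨z⟩ }

/-- Both vertices descend to the indicator of `G`; join the two descents there. -/
theorem dist_add_le (G : Finset ℕ) (x y : Vertex n) (hGx : G ⊆ ones x.1) (hGy : G ⊆ ones y.1)
    (hconv : ∀ i ∈ G, ∀ j ∈ G, (Finset.Icc i j ⊆ ones x.1 ∨ Finset.Icc i j ⊆ ones y.1) →
      Finset.Icc i j ⊆ G) :
    (graph n).dist x y + 2 * G.card ≤ (ones x.1).card + (ones y.1).card := by
  obtain ⟨z, w, hz, hw⟩ := exists_walk_of_convex G x hGx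
    (fun i hi j hj h => hconv i hi j hj (Or.inl h))
  obtain ⟨z', w', hz', hw'⟩ := exists_walk_of_convex G y hGy
    (fun i hi j hj h => hconv i hi j hj (Or.inr h))
  obtain rfl : z = z' := Vertex.ext_ones (by rw [hz, hz'])
  have := SimpleGraph.dist_le (w.append w'.reverse)
  rw [SimpleGraph.Walk.length_append, SimpleGraph.Walk.length_reverse] at this
  omega

/-! ### Coordinate flips along a walk -/

/-- The number of steps of a walk that change the `i`-th coordinate. -/
def flips (i : Fin n) : {x y : Vertex n} → (graph n).Walk x y → ℕ
  | _, _, .nil => 0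
  | x, _, .cons (v := v) _ w => (if x.1 i ≠ v.1 i then 1 else 0) + flips i w

theorem sum_flips {x y : Vertex n} (w : (graph n).Walk x y) : ∑ i, flips i w = w.length := by
  induction w with
  | nil => simp [flips]
  | cons h w ih =>
    simp only [flips, Finset.sum_add_distrib, ih, SimpleGraph.Walk.length_cons]
    rw [Finset.sum_boole, add_comm]
    -- The remaining cardinality is the Hamming distance of the step, which adjacency makes `1`.
    congr 1

theorem eq_of_flips_eq_zero {x y : Vertex n} (w : (graph n).Walk x y) {i : Fin n}
    (h : flips i w = 0) : x.1 i = y.1 i := by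
  induction w with
  | nil => rfl
  | cons hadj w ih =>
    simp only [flips] at h
    have h1 := ih (by omega)
    by_contra hne
    rw [← h1, ← Ne] at hne
    rw [if_pos hne] at h
    omega

theorem two_le_flips {x y : Vertex n} (w : (graph n).Walk x y) {i : Fin n}
    (hxy : x.1 i = y.1 i) (h : flips i w ≠ 0) : 2 ≤ flips i w := by
  induction w with
  | nil => simp [flips] at h
  | @cons u v y hadj w ih =>
    simp only [flips] at h ⊢
    by_cases huv : u.1 i = v.1 i
    · have := ih (huv ▸ hxy) (by simpa [huv] using h)
      omega
    · rw [if_pos huv]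
      have : flips i w ≠ 0 := fun h0 => huv (hxy.trans (eq_of_flips_eq_zero w h0).symm)
      omega

/-- Even a run of length one needs two zeros after it. -/
theorem Vertex.not_isolated_zero (x : Vertex n) {z : ℕ} (h1 : z ∈ ones x.1)
    (h2 : z + 1 ∉ ones x.1) : z + 2 ∉ ones x.1 :=
  (x.zeros_after_run (a := z) (b := z + 1) (by omega) (fun i hi hi' => by
    obtain rfl : i = z := by omega
    exact h1) h2).2 _ (by omega) (by omega)

/-- A single flip that breaks the block while keeping its ends would leave the forbidden pattern
`101`. -/
theorem Icc_subset_ones_of_adj {x y : Vertex n} (h : (graph n).Adj x y) {i j : ℕ}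
    (hi : i ∈ ones y.1) (hj : j ∈ ones y.1) (hx : Finset.Icc i j ⊆ ones x.1) :
    Finset.Icc i j ⊆ ones y.1 := by
  intro z hz
  by_contra hzy
  have hd : hammingDist x.1 y.1 = 1 := h
  rw [hammingDist, Finset.card_eq_one] at hd
  obtain ⟨e, he⟩ := hd
  have hzx := hx hz
  have hzn := lt_of_mem_ones hzx
  have hother : ∀ k ∈ Finset.Icc i j, k ≠ z → k ∈ ones y.1 := by
    intro k hk hkz
    have hkx := hx hk
    have hkn := lt_of_mem_ones hkx
    by_contra hky
    have h1 : (⟨z, hzn⟩ : Fin n) = e := by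
      rw [← Finset.mem_singleton, ← he, Finset.mem_filter]
      refine ⟨Finset.mem_univ _, fun heq => hzy ?_⟩
      rw [mem_ones] at hzx ⊢
      exact ⟨hzn, heq ▸ hzx.2⟩
    have h2 : (⟨k, hkn⟩ : Fin n) = e := by
      rw [← Finset.mem_singleton, ← he, Finset.mem_filter]
      refine ⟨Finset.mem_univ _, fun heq => hky ?_⟩
      rw [mem_ones] at hkx ⊢
      exact ⟨hkn, heq ▸ hkx.2⟩
    exact hkz (by simpa using h2.trans h1.symm)
  rw [Finset.mem_Icc] at hz
  have hzi : z ≠ i := fun h => hzy (h ▸ hi)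
  have hzj : z ≠ j := fun h => hzy (h ▸ hj)
  refine y.not_isolated_zero (z := z - 1)
    (hother _ (Finset.mem_Icc.2 ⟨by omega, by omega⟩) (by omega)) ?_
    (hother _ (Finset.mem_Icc.2 ⟨by omega, by omega⟩) (by omega))
  rwa [show z - 1 + 1 = z by omega]

theorem Icc_subset_ones_iff_of_walk {x y : Vertex n} (w : (graph n).Walk x y) {i j : Fin n}
    (hi : flips i w = 0) (hj : flips j w = 0) (hix : (i : ℕ) ∈ ones x.1)
    (hjx : (j : ℕ) ∈ ones x.1) :
    Finset.Icc (i : ℕ) j ⊆ ones x.1 ↔ Finset.Icc (i : ℕ) j ⊆ ones y.1 := by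
  induction w with
  | nil => rfl
  | @cons u v y hadj w ih =>
    simp only [flips, Nat.add_eq_zero_iff, ite_eq_right_iff, one_ne_zero, imp_false, not_not]
      at hi hj
    have hiv : (i : ℕ) ∈ ones v.1 := by
      rw [coe_mem_ones] at hix ⊢; rw [← hi.1, hix]
    have hjv : (j : ℕ) ∈ ones v.1 := by
      rw [coe_mem_ones] at hjx ⊢; rw [← hj.1, hjx]
    rw [← ih hi.2 hj.2 hiv hjv]
    exact ⟨Icc_subset_ones_of_adj hadj hiv hjv, Icc_subset_ones_of_adj hadj.symm hix hjx⟩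

/-- The common ones that a walk never changes. -/
def unflipped {x y : Vertex n} (w : (graph n).Walk x y) : Finset ℕ :=
  (Finset.univ.filter (fun i : Fin n => flips i w = 0 ∧ x.1 i = true)).map Fin.valEmbedding

theorem mem_unflipped {x y : Vertex n} {w : (graph n).Walk x y} {i : ℕ} :
    i ∈ unflipped w ↔ ∃ h : i < n, flips ⟨i, h⟩ w = 0 ∧ x.1 ⟨i, h⟩ = true := by
  simp only [unflipped, Finset.mem_map, Finset.mem_filter, Finset.mem_univ, true_and,
    Fin.valEmbedding_apply]
  constructor
  · rintro ⟨j, hj, rfl⟩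
    exact ⟨j.2, hj⟩
  · rintro ⟨h, hx⟩
    exact ⟨⟨i, h⟩, hx, rfl⟩

theorem unflipped_subset {x y : Vertex n} (w : (graph n).Walk x y) :
    unflipped w ⊆ ones x.1 ∩ ones y.1 := by
  intro i hi
  obtain ⟨h, h0, h1⟩ := mem_unflipped.1 hi
  rw [Finset.mem_inter, mem_ones, mem_ones]
  exact ⟨⟨h, h1⟩, h, (eq_of_flips_eq_zero w h0) ▸ h1⟩

theorem card_ones {x : Fin n → Bool} :
    (ones x).card = ∑ i, if x i = true then 1 else 0 := by
  rw [ones, Finset.card_map, Finset.card_filter]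

/-- The inequality holds coordinate by coordinate: a differing coordinate flips at least once, a
common one flips at least twice unless it is untouched. -/
theorem card_add_card_le {x y : Vertex n} (w : (graph n).Walk x y) :
    (ones x.1).card + (ones y.1).card ≤ w.length + 2 * (unflipped w).card := by
  rw [card_ones, card_ones, ← sum_flips, unflipped, Finset.card_map, Finset.card_filter,
    Finset.mul_sum, ← Finset.sum_add_distrib, ← Finset.sum_add_distrib]
  apply Finset.sum_le_sum
  intro i _
  have h1 := two_le_flips w (i := i)
  have h2 := eq_of_flips_eq_zero w (i := i)
  by_cases h0 : flips i w = 0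
  · have := h2 h0
    rw [← this]
    split_ifs <;> simp_all
  · by_cases hxy : x.1 i = y.1 i
    · have := h1 hxy h0
      split_ifs <;> omega
    · have : ¬ (x.1 i = true ∧ y.1 i = true) := fun h => hxy (h.1.trans h.2.symm)
      split_ifs <;> first | omega | simp_all

end

/-! ### H-type pairs have no common ones -/

theorem forall₂_completeHType (p : ℕ) :
    List.Forall₂ (fun c d => ¬ (c = true ∧ d = true)) (completeHType p true)
      (completeHType p false) := by
  have hrep : ∀ (k : ℕ) (c d : Bool), ¬ (c = true ∧ d = true) →
      List.Forall₂ (fun c d => ¬ (c = true ∧ d = true)) (List.replicate k c)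
        (List.replicate k d) := by
    intro k c d h
    induction k with
    | zero => simp
    | succ k ih => rw [List.replicate_succ, List.replicate_succ]; exact .cons h ih
  unfold completeHType
  refine List.rel_append (List.rel_append ?_ (hrep _ _ _ (by simp))) (hrep _ _ _ (by simp))
  generalize List.range (2 * p + 2) = l
  induction l with
  | nil => simp
  | cons i l ih =>
    rw [List.flatMap_cons, List.flatMap_cons]
    refine List.rel_append (hrep _ _ _ ?_) ih
    split_ifs <;> simp

theorem IsHTypePair.disjoint {n p : ℕ} {μ ν : Fin n → Bool} (h : IsHTypePair p μ ν) :
    Disjoint (ones μ) (ones ν) := by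
  have key : ∀ {μ ν : Fin n → Bool}, List.ofFn μ <:+ completeHType p true →
      List.ofFn ν <:+ completeHType p false → Disjoint (ones μ) (ones ν) := by
    intro μ ν h1 h2
    have hF := forall₂_completeHType p
    rw [List.suffix_iff_eq_drop, List.length_ofFn] at h1 h2
    -- The complete words have equal length, so suffixes of equal length stay aligned.
    have hd := List.forall₂_drop ((completeHType p true).length - n) hF
    rw [← h1, hF.length_eq, ← h2] at hd
    rw [Finset.disjoint_left]
    intro i hi hi'
    obtain ⟨hn, h3⟩ := mem_ones.1 hi
    obtain ⟨_, h4⟩ := mem_ones.1 hi'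
    have := hd.get (i := i) (by simpa using hn) (by simpa using hn)
    simp only [List.get_eq_getElem, List.getElem_ofFn] at this
    exact this ⟨h3, h4⟩
  rcases h with ⟨h1, h2⟩ | ⟨h1, h2⟩
  · exact key h1 h2
  · exact (key h2 h1).symm

/-! ### The distance in terms of the maximal barriers -/

section

variable {n s : ℕ} {x y : Vertex n} {B : Fin s → Barrier}

theorem card_ones_inter_eq_sum
    (huniq : ∀ i ∈ ones x.1 ∩ ones y.1,
      ∃! D, IsMaximalDistanceBarrier x.1 y.1 D ∧ i ∈ D.positions)
    (hBinj : Function.Injective B)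
    (hB : ∀ D, IsMaximalDistanceBarrier x.1 y.1 D ↔ ∃ k, B k = D) :
    (ones x.1 ∩ ones y.1).card = ∑ k, (B k).C' := by
  have hmax : ∀ k, IsMaximalDistanceBarrier x.1 y.1 (B k) := fun k => (hB _).2 ⟨k, rfl⟩
  rw [← Finset.sum_congr rfl fun k _ => (hmax k).1.card_common, ← Finset.card_biUnion]
  · congr 1
    ext i
    simp only [Finset.mem_biUnion, Finset.mem_univ, true_and]
    constructor
    · intro hi
      obtain ⟨D, ⟨hD, hiD⟩, -⟩ := huniq i hi
      obtain ⟨k, rfl⟩ := (hB D).1 hD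
      exact ⟨k, Finset.mem_filter.2 ⟨hiD, hi⟩⟩
    · rintro ⟨k, hk⟩
      exact (Finset.mem_filter.1 hk).2
  · intro k _ l _ hkl
    refine Finset.disjoint_left.2 fun i hi hi' => ?_
    rw [Finset.mem_filter] at hi hi'
    exact hkl (hBinj ((huniq i hi.2).unique ⟨hmax k, hi.1⟩ ⟨hmax l, hi'.1⟩))

theorem dist_add_sum_le
    (huniq : ∀ i ∈ ones x.1 ∩ ones y.1,
      ∃! D, IsMaximalDistanceBarrier x.1 y.1 D ∧ i ∈ D.positions)
    (hBinj : Function.Injective B)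
    (hB : ∀ D, IsMaximalDistanceBarrier x.1 y.1 D ↔ ∃ k, B k = D) :
    (graph n).dist x y + 2 * ∑ k, (B k).M ≤ (ones x.1).card + (ones y.1).card := by
  have hmax : ∀ k, IsMaximalDistanceBarrier x.1 y.1 (B k) := fun k => (hB _).2 ⟨k, rfl⟩
  choose c hc using fun k => (hmax k).1.exists_block
  have hG : (Finset.univ.biUnion fun k => Finset.Ico (c k) (c k + (B k).M)).card =
      ∑ k, (B k).M := by
    rw [Finset.card_biUnion]
    · simp
    · intro k _ l _ hkl
      refine Finset.disjoint_left.2 fun i hi hi' => ?_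
      exact hkl (hBinj ((huniq i (hc k i hi).2).unique ⟨hmax k, (hc k i hi).1⟩
        ⟨hmax l, (hc l i hi').1⟩))
  rw [← hG]
  apply dist_add_le
  · intro i hi
    obtain ⟨k, -, hk⟩ := Finset.mem_biUnion.1 hi
    exact (Finset.mem_inter.1 (hc k i hk).2).1
  · intro i hi
    obtain ⟨k, -, hk⟩ := Finset.mem_biUnion.1 hi
    exact (Finset.mem_inter.1 (hc k i hk).2).2
  · intro i hi j hj h e he
    obtain ⟨k, -, hk⟩ := Finset.mem_biUnion.1 hi
    obtain ⟨l, -, hl⟩ := Finset.mem_biUnion.1 hj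
    rw [Finset.mem_Icc] at he
    -- Two kept ones in one run come from the same barrier, hence from the same kept block, which is
    -- an interval.
    obtain rfl : k = l := hBinj (eq_of_Icc_subset_ones huniq (he.1.trans he.2) h (hc k i hk).2
      (hc l j hl).2 (hmax k) (hc k i hk).1 (hmax l) (hc l j hl).1)
    rw [Finset.mem_Ico] at hk hl
    exact Finset.mem_biUnion.2 ⟨k, Finset.mem_univ _, Finset.mem_Ico.2 ⟨by omega, by omega⟩⟩

/-- The full row joins any two untouched ones by ones; the walk transports this to the other end, so
all of them lie in one block of the broken row. -/
theorem card_unflipped_inter_le_M (w : (graph n).Walk x y) {D : Barrier}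
    (hD : IsDistanceBarrier x.1 y.1 D) : (unflipped w ∩ D.positions).card ≤ D.M := by
  refine hD.card_le_M Finset.inter_subset_right fun i hi j hj _ => ?_
  rw [Finset.mem_inter] at hi hj
  have hsub : Finset.Icc i j ⊆ D.positions := by
    intro e he
    have h1 := hi.2
    have h2 := hj.2
    rw [Barrier.positions, Finset.mem_Ico] at h1 h2 ⊢
    rw [Finset.mem_Icc] at he
    omega
  obtain ⟨hin, hi0, hix⟩ := mem_unflipped.1 hi.1
  obtain ⟨hjn, hj0, hjx⟩ := mem_unflipped.1 hj.1
  have hiff := Icc_subset_ones_iff_of_walk w hi0 hj0 (mem_ones.2 ⟨hin, hix⟩) (mem_ones.2 ⟨hjn, hjx⟩)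
  rw [Finset.subset_inter_iff]
  rcases hD.full with h | h
  · exact ⟨hsub.trans h, hiff.1 (hsub.trans h)⟩
  · exact ⟨hiff.2 (hsub.trans h), hsub.trans h⟩

theorem le_dist_add_sum
    (hcover : ∀ i ∈ ones x.1 ∩ ones y.1, ∃ k, i ∈ (B k).positions)
    (hB : ∀ k, IsDistanceBarrier x.1 y.1 (B k)) :
    (ones x.1).card + (ones y.1).card ≤ (graph n).dist x y + 2 * ∑ k, (B k).M := by
  obtain ⟨w, hw⟩ := (graph_connected n).exists_walk_length_eq_dist x y
  have h1 := card_add_card_le w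
  have h2 : (unflipped w).card ≤ ∑ k, (B k).M := by
    have hsub : unflipped w ⊆ Finset.univ.biUnion fun k => unflipped w ∩ (B k).positions := by
      intro i hi
      obtain ⟨k, hk⟩ := hcover i (unflipped_subset w hi)
      exact Finset.mem_biUnion.2 ⟨k, Finset.mem_univ _, Finset.mem_inter.2 ⟨hi, hk⟩⟩
    calc (unflipped w).card ≤ _ := Finset.card_le_card hsub
      _ ≤ ∑ k, (unflipped w ∩ (B k).positions).card := Finset.card_biUnion_le
      _ ≤ _ := Finset.sum_le_sum fun k _ => card_unflipped_inter_le_M w (hB k)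
  omega

/-- Both bounds with nothing kept: `G = ∅` above, an empty family of barriers below. -/
theorem dist_eq_of_disjoint (h : Disjoint (ones x.1) (ones y.1)) :
    (graph n).dist x y = (ones x.1).card + (ones y.1).card := by
  apply le_antisymm
  · have := dist_add_le ∅ x y (by simp) (by simp) (by simp)
    simpa using this
  · have := le_dist_add_sum (x := x) (y := y) (B := (Fin.elim0 : Fin 0 → Barrier))
      (by rw [Finset.disjoint_iff_inter_eq_empty.1 h]; simp) (fun k => k.elim0)
    simpa using this

theorem IsNHTypePair.ones_union {μ ν α β : Fin n → Bool} (h : IsNHTypePair μ ν α β) :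
    ones α ∪ ones β = ones μ ∪ ones ν := by
  ext i
  by_cases hn : i < n
  · have := h.1 ⟨i, hn⟩
    simp only [Finset.mem_union, mem_ones, hn, exists_true_left]
    rw [← not_iff_not, not_or, not_or]
    simpa using this
  · simp [mem_ones, hn]

end

end FibRun

theorem lemma3p10 (n p s : ℕ) (μ ν α β : FibRun.Vertex n)
    (hH : FibRun.IsHTypePair p μ.1 ν.1)
    (hNH : FibRun.IsNHTypePair μ.1 ν.1 α.1 β.1)
    (B : Fin s → FibRun.Barrier) (hBinj : Function.Injective B)
    (hB : ∀ D, FibRun.IsMaximalDistanceBarrier α.1 β.1 D ↔ ∃ k, B k = D) :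
    (FibRun.graph n).Connected ∧
    ((FibRun.graph n).dist α β : ℤ) =
      (FibRun.graph n).dist μ ν + ∑ k, (((B k).C : ℤ) - (B k).M) ∧
    ((FibRun.graph n).dist α β : ℤ) =
      (FibRun.graph n).dist μ ν + ∑ k, (((B k).C' : ℤ) - 2 * (B k).M) := by
  have huniq : ∀ i ∈ FibRun.ones α.1 ∩ FibRun.ones β.1,
      ∃! D, FibRun.IsMaximalDistanceBarrier α.1 β.1 D ∧ i ∈ D.positions := by
    intro i hi
    obtain ⟨h1, h2⟩ := Finset.mem_inter.1 hi
    obtain ⟨hn, h1⟩ := FibRun.mem_ones.1 h1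
    obtain ⟨_, h2⟩ := FibRun.mem_ones.1 h2
    exact hNH.2 ⟨i, hn⟩ h1 h2
  have hupper := FibRun.dist_add_sum_le huniq hBinj hB
  have hlower := FibRun.le_dist_add_sum (x := α) (y := β) (B := B) (fun i hi => by
    obtain ⟨D, ⟨hD, hiD⟩, -⟩ := huniq i hi
    obtain ⟨k, rfl⟩ := (hB D).1 hD
    exact ⟨k, hiD⟩) (fun k => ((hB _).2 ⟨k, rfl⟩).1)
  have hcommon := FibRun.card_ones_inter_eq_sum huniq hBinj hB
  have hdist := FibRun.dist_eq_of_disjoint hH.disjoint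
  -- Having the same common zeros turns `d(μ, ν)` into `|α ∪ β|`.
  rw [← Finset.card_union_of_disjoint hH.disjoint, ← hNH.ones_union] at hdist
  have hcard := Finset.card_union_add_card_inter (FibRun.ones α.1) (FibRun.ones β.1)
  have hC : ∑ k, (((B k).C' : ℤ) - 2 * (B k).M) = (∑ k, (B k).C' : ℕ) - 2 * (∑ k, (B k).M : ℕ) := by
    push_cast
    rw [Finset.sum_sub_distrib, Finset.mul_sum]
  have hmain : ((FibRun.graph n).dist α β : ℤ) =
      (FibRun.graph n).dist μ ν + ∑ k, (((B k).C' : ℤ) - 2 * (B k).M) := by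
    rw [hC]
    omega
  refine ⟨FibRun.graph_connected n, ?_, hmain⟩
  rw [hmain]
  congr 1
  refine Finset.sum_congr rfl fun k _ => ?_
  have := (B k).C_add_M
  omega
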